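/- Let $\mathbb K$ be a field, let $s\ge 1$ and $N\ge 2$ be integers, let $E$ be the $\mathbb K$-vector space with basis $x^0,\dots,x^s$ (the dual of $\mathbb K^{s+1}$, the basis being dual to the canonical basis $(e_\lambda)$), and let $R\subset E^{\otimes N}$ be a linear subspace. Let $\mathcal A=A(E,R)=T(E)/(R)$ be the corresponding $N$-homogeneous algebra, and put $J_n=\bigcap_{r+N\le n}E^{\otimes r}\otimes R\otimes E^{\otimes (n-N-r)}\subset E^{\otimes n}$ (so $J_n=E^{\otimes n}$ for $n<N$), which is the dual space $(\mathcal A^!_n)^*$ of the degree $n$ component of the dual algebra $\mathcal A^!=A(E^*,R^\perp)$. Let $d:\mathcal A\otimes J_{n+1}\to\mathcal A\otimes J_n$ be induced by $a\otimes(v_0\otimes v_1\otimes\cdots\otimes v_n)\mapsto av_0\otimes(v_1\otimes\cdots\otimes v_n)$, and let $\nu_N(2k)=Nk$, $\nu_N(2k+1)=Nk+1$. The Koszul complex $\mathcal K$ of $\mathcal A$ has the terms $\mathcal K_n=\mathcal A\otimes J_{\nu_N(n)}$, $n\ge0$, with differential $d:\mathcal K_{2k+1}\to\mathcal K_{2k}$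 and $d^{N-1}:\mathcal K_{2k+2}\to\mathcal K_{2k+1}$; $\mathcal A$ is Koszul if $\mathcal K$ is acyclic in positive degrees. A Koszul algebra $\mathcal A$ of finite global dimension $D$ is Gorenstein if the cohomology of the complex $\mathrm{Hom}_{\mathcal A}(\mathcal K,\mathcal A)$ of right $\mathcal A$-modules vanishes in the degrees $n<D$ and is isomorphic to the trivial right $\mathcal A$-module $\mathbb K$ in degree $D$. An $m$-linear form $w$ on $V=\mathbb K^{s+1}$ is preregular if (i) $w(X,X_1,\dots,X_{m-1})=0$ for all $X_1,\dots,X_{m-1}\in V$ implies $X=0$, and (ii) there is a $Q\in GL(V)$ with $w(X_1,\dots,X_m)=w(QX_m,X_1,\dots,X_{m-1})$ for all $X_1,\dots,X_m\in V$. It is 1-site nondegenerate if the analogue of (i) holds for each of the $m$ arguments of $w$. For $m\ge N$ let $\mathcal A(w,N)=A(E,R_w)$, where $R_w\subset E^{\otimes N}$ is spanned by the tensors $\sum_{\mu_1,\dots,\mu_N}W_{\lambda_1\dots\lambda_{m-N}\mu_1\dots\mu_N}x^{\mu_1}\otimes\cdots\otimes x^{\mu_N}$ with $\lambda_1,\dots,\lambda_{m-N}\in\{0,\dots,s\}$,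 and $W_{\lambda_1\dots\lambda_m}=w(e_{\lambda_1},\dots,e_{\lambda_m})$. Theorem. Assume that $\mathcal A=A(E,R)$ is Koszul of finite global dimension $D$ and Gorenstein. Then there is an integer $m\ge N$ such that $m=Np+1$ and $D=2p+1$ for some integer $p\ge1$ if $N\ge3$, and $m=D$ if $N=2$, and there is a preregular $m$-linear form $w$ on $\mathbb K^{s+1}$ (so $w$ is 1-site nondegenerate and twisted cyclic) such that $\mathcal A=\mathcal A(w,N)$, i.e. $R=R_w$. Moreover $w$ is unique up to a factor in $\mathbb K\setminus\{0\}$: if $w$ and $w'$ are preregular $m$-linear forms on $\mathbb K^{s+1}$ with $R=R_w=R_{w'}$, then $w'=cw$ for some $c\in\mathbb K\setminus\{0\}$. -/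

import Mathlib

open scoped TensorProduct

namespace KoszulGorenstein

universe u

/-! ### Tensors in coordinates

`E` is the vector space with basis `x^0, …, x^(g-1)`. A tensor in `E^{⊗n}` is given by its
components, one for every word of length `n` in the letters `0, …, g-1`. -/

/-- `E^{⊗n}`: the family `t` stands for `∑ t (λ₁,…,λₙ) x^{λ₁} ⊗ ⋯ ⊗ x^{λₙ}`. -/
abbrev Tensor (K : Type u) (g n : ℕ) : Type u := (Fin n → Fin g) → K

section Algebra

variable {K : Type u} [Field K] {g N : ℕ}

/-- The inclusion `E^{⊗n} → T(E)` into the tensor algebra, i.e. into the free algebra on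
`x^0, …, x^(g-1)`. -/
noncomputable def toFree (n : ℕ) : Tensor K g n →ₗ[K] FreeAlgebra K (Fin g) :=
  Fintype.linearCombination K fun c => (List.ofFn fun i => FreeAlgebra.ι K (c i)).prod

/-- The relations `t = 0`, for `t ∈ R ⊆ E^{⊗N}`. -/
def Rel (R : Submodule K (Tensor K g N)) (a b : FreeAlgebra K (Fin g)) : Prop :=
  ∃ t ∈ R, a = toFree N t ∧ b = 0

/-- The `N`-homogeneous algebra `A(E,R) = T(E)/(R)`. -/
def HomAlg (R : Submodule K (Tensor K g N)) : Type u := RingQuot (Rel R)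

noncomputable instance (R : Submodule K (Tensor K g N)) : Ring (HomAlg R) :=
  inferInstanceAs (Ring (RingQuot (Rel R)))

noncomputable instance (R : Submodule K (Tensor K g N)) : Algebra K (HomAlg R) :=
  inferInstanceAs (Algebra K (RingQuot (Rel R)))

/-- The generator `x^l` of `A(E,R)`. -/
noncomputable def gen (R : Submodule K (Tensor K g N)) (l : Fin g) : HomAlg R :=
  RingQuot.mkAlgHom K (Rel R) (FreeAlgebra.ι K l)

theorem lift_zero_toFree (hN : N ≠ 0) (t : Tensor K g N) :
    FreeAlgebra.lift K (fun _ : Fin g => (0 : K)) (toFree N t) = 0 := by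
  obtain ⟨n, rfl⟩ := Nat.exists_eq_succ_of_ne_zero hN
  simp [toFree, Fintype.linearCombination_apply, List.ofFn_succ]

/-- The augmentation `ε : A(E,R) → K`, the projection on degree `0`. -/
noncomputable def augmentation (hN : N ≠ 0) (R : Submodule K (Tensor K g N)) :
    HomAlg R →ₐ[K] K :=
  RingQuot.liftAlgHom K (s := Rel R) ⟨FreeAlgebra.lift K (fun _ => (0 : K)), by
    rintro a b ⟨t, -, rfl, rfl⟩
    rw [lift_zero_toFree hN, map_zero]⟩

/-! ### The Koszul complex -/

/-- The word `c` with the `N` letters at the places `r, …, r+N-1` replaced by those of `v`. -/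
def overwrite {n : ℕ} (r : ℕ) (c : Fin n → Fin g) (v : Fin N → Fin g) : Fin n → Fin g :=
  fun i => if h : r ≤ i.val ∧ i.val < r + N then v ⟨i.val - r, by omega⟩ else c i

/-- `(A^!_n)^* = ⋂_{r+N ≤ n} E^{⊗r} ⊗ R ⊗ E^{⊗(n-N-r)} ⊆ E^{⊗n}`, the space of the tensors whose
slices along any `N` consecutive places lie in `R`. It is all of `E^{⊗n}` if `n < N`. -/
def dualSpace (R : Submodule K (Tensor K g N)) (n : ℕ) : Submodule K (Tensor K g n) where
  carrier := {t | ∀ r, r + N ≤ n → ∀ c : Fin n → Fin g, (fun v => t (overwrite r c v)) ∈ R}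
  zero_mem' := fun _ _ _ => R.zero_mem
  add_mem' := fun hs ht r hr c => R.add_mem (hs r hr c) (ht r hr c)
  smul_mem' := fun k _ ht r hr c => R.smul_mem k (ht r hr c)

theorem cons_overwrite {n : ℕ} (l : Fin g) (r : ℕ) (c : Fin n → Fin g) (v : Fin N → Fin g) :
    (Fin.cons l (overwrite r c v) : Fin (n + 1) → Fin g) =
      overwrite (r + 1) (Fin.cons l c) v := by
  funext i
  refine Fin.cases ?_ (fun j => ?_) i
  · simp [overwrite]
  · simp only [overwrite, Fin.cons_succ, Fin.val_succ]
    by_cases h : r ≤ j.val ∧ j.val < r + N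
    · rw [dif_pos h, dif_pos (by omega)]
      congr 2
      omega
    · rw [dif_neg h, dif_neg (by omega)]

/-- Splitting off the first letter: `t = ∑_l x^l ⊗ contract l t`. -/
def contract (R : Submodule K (Tensor K g N)) (n : ℕ) (l : Fin g) :
    dualSpace R (n + 1) →ₗ[K] dualSpace R n where
  toFun t := ⟨fun c => t.1 (Fin.cons l c), fun r hr c => by
    simp only [cons_overwrite]
    exact t.2 (r + 1) (by omega) (Fin.cons l c)⟩
  map_add' _ _ := rfl
  map_smul' _ _ := rfl

/-- The left `A`-module `A ⊗ (A^!_n)^*`. -/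
abbrev KN (R : Submodule K (Tensor K g N)) (n : ℕ) : Type u := HomAlg R ⊗[K] dualSpace R n

/-- The `N`-differential `d : A ⊗ (A^!_{n+1})^* → A ⊗ (A^!_n)^*`,
`a ⊗ (e₁ ⊗ ⋯ ⊗ e_{n+1}) ↦ a e₁ ⊗ (e₂ ⊗ ⋯ ⊗ e_{n+1})`. -/
noncomputable def d (R : Submodule K (Tensor K g N)) (n : ℕ) :
    KN R (n + 1) →ₗ[HomAlg R] KN R n :=
  ∑ l : Fin g, TensorProduct.AlgebraTensorModule.map
    (LinearMap.toSpanSingleton (HomAlg R) (HomAlg R) (gen R l)) (contract R n l)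

/-- The iterate `d^k`. -/
noncomputable def dPow (R : Submodule K (Tensor K g N)) (n : ℕ) :
    (k : ℕ) → (KN R (n + k) →ₗ[HomAlg R] KN R n)
  | 0 => LinearMap.id
  | k + 1 => dPow R n k ∘ₗ d R (n + k)

/-- The order of the differential from the term `n + 1` to the term `n` of the Koszul complex. -/
def step (N n : ℕ) : ℕ := if Even n then 1 else N - 1

/-- The degree `ν_N(n)`: see `nu_even` and `nu_odd`. -/
def nu (N : ℕ) : ℕ → ℕ
  | 0 => 0
  | n + 1 => nu N n + step N n

theorem nu_even_odd (hN : N ≠ 0) (k : ℕ) : nu N (2 * k) = N * k ∧ nu N (2 * k + 1) = N * k + 1 := by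
  induction k with
  | zero => simp [nu, step]
  | succ k ih =>
    have h : nu N (2 * (k + 1)) = N * (k + 1) := by
      change nu N (2 * k + 1) + step N (2 * k + 1) = _
      rw [ih.2, step, if_neg (by simp), mul_add]
      omega
    refine ⟨h, ?_⟩
    change nu N (2 * (k + 1)) + step N (2 * (k + 1)) = _
    rw [h, step, if_pos (by simp)]

theorem nu_even (hN : N ≠ 0) (k : ℕ) : nu N (2 * k) = N * k := (nu_even_odd hN k).1

theorem nu_odd (hN : N ≠ 0) (k : ℕ) : nu N (2 * k + 1) = N * k + 1 := (nu_even_odd hN k).2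

/-- The term `A ⊗ (A^!_{ν_N(n)})^*` of the Koszul complex. -/
abbrev Koszul (R : Submodule K (Tensor K g N)) (n : ℕ) : Type u := KN R (nu N n)

/-- The differential of the Koszul complex: alternately `d` and `d^{N-1}`. -/
noncomputable def koszulD (R : Submodule K (Tensor K g N)) (n : ℕ) :
    Koszul R (n + 1) →ₗ[HomAlg R] Koszul R n :=
  dPow R (nu N n) (step N n)

/-- `A(E,R)` is Koszul: its Koszul complex is acyclic in positive degrees. -/
def IsKoszul (R : Submodule K (Tensor K g N)) : Prop :=
  ∀ n, Function.Exact (koszulD R (n + 1)) (koszulD R n)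

/-! ### Global dimension and the Gorenstein property -/

/-- The (left) global dimension of the ring `A` is `D`. -/
def HasGlobalDimension (A : Type u) [Ring A] (D : ℕ) : Prop :=
  (⨆ M : ModuleCat.{u} A, CategoryTheory.projectiveDimension M) = (D : WithBot ℕ∞)

/-- The right `A`-module `Hom_A(K_n, A)` of left `A`-linear maps on the Koszul complex. -/
abbrev Cochain (R : Submodule K (Tensor K g N)) (n : ℕ) : Type u :=
  Koszul R n →ₗ[HomAlg R] HomAlg R

/-- The transposed differential `Hom_A(K_n, A) → Hom_A(K_{n+1}, A)`, right `A`-linear. -/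
noncomputable def coD (R : Submodule K (Tensor K g N)) (n : ℕ) :
    Cochain R n →ₗ[(HomAlg R)ᵐᵒᵖ] Cochain R (n + 1) :=
  LinearMap.lcomp (HomAlg R)ᵐᵒᵖ (HomAlg R) (koszulD R n)

/-- The cocycles in `Hom_A(K_n, A)`. -/
noncomputable def cocycles (R : Submodule K (Tensor K g N)) (n : ℕ) :
    Submodule (HomAlg R)ᵐᵒᵖ (Cochain R n) :=
  LinearMap.ker (coD R n)

/-- The coboundaries in `Hom_A(K_n, A)`. -/
noncomputable def coboundaries (R : Submodule K (Tensor K g N)) :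
    (n : ℕ) → Submodule (HomAlg R)ᵐᵒᵖ (Cochain R n)
  | 0 => ⊥
  | n + 1 => LinearMap.range (coD R n)

/-- The cohomology `H^n` of `Hom_A(K_•, A)`, a right `A`-module: the cocycles modulo the
coboundaries, as a submodule of the cochains modulo the coboundaries. -/
noncomputable def cohomology (R : Submodule K (Tensor K g N)) (n : ℕ) :
    Submodule (HomAlg R)ᵐᵒᵖ (Cochain R n ⧸ coboundaries R n) :=
  (cocycles R n).map (coboundaries R n).mkQ

/-- The Gorenstein property of a Koszul algebra of global dimension `D`: `H^n = 0` for `n < D`,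
and `H^D` is isomorphic to the trivial right `A`-module `K`, on which `A` acts through `ε`. -/
def IsGorenstein (hN : N ≠ 0) (R : Submodule K (Tensor K g N)) (D : ℕ) : Prop :=
  (∀ n < D, cohomology R n = ⊥) ∧
    ∃ φ : cohomology R D ≃+ K, ∀ (h : cohomology R D) (a : HomAlg R),
      φ (MulOpposite.op a • h) = φ h * augmentation hN R a

end Algebra

/-! ### Multilinear forms -/

section Forms

variable {K V : Type*} [Field K] [AddCommGroup V] [Module K V] {m : ℕ}

/-- The family `(Q X_m, X_1, …, X_{m-1})`. -/
def twistedRotate (Q : V ≃ₗ[K] V) (X : Fin m → V) : Fin m → V :=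
  fun i => if i.val = 0 then Q (X ⟨m - 1, by have := i.isLt; omega⟩) else X ⟨i.val - 1, by have := i.isLt; omega⟩

/-- `w` is nondegenerate at the site `i`. -/
def NondegenerateAt (w : MultilinearMap K (fun _ : Fin m => V) K) (i : Fin m) : Prop :=
  ∀ X : V, (∀ Y : Fin m → V, w (Function.update Y i X) = 0) → X = 0

/-- `w` is `Q`-cyclic: `w(X_1, …, X_m) = w(Q X_m, X_1, …, X_{m-1})`. -/
def IsTwistedCyclic (w : MultilinearMap K (fun _ : Fin m => V) K) (Q : V ≃ₗ[K] V) : Prop :=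
  ∀ X : Fin m → V, w X = w (twistedRotate Q X)

/-- `w` is preregular: it is nondegenerate at the first site, and it is `Q`-cyclic for some
`Q ∈ GL(V)`. (Then it is nondegenerate at every site.) -/
def IsPreregular (w : MultilinearMap K (fun _ : Fin m => V) K) : Prop :=
  (∀ i : Fin m, i.val = 0 → NondegenerateAt w i) ∧ ∃ Q : V ≃ₗ[K] V, IsTwistedCyclic w Q

/-- `w` is 1-site nondegenerate: it is nondegenerate at every site. -/
def IsOneSiteNondegenerate (w : MultilinearMap K (fun _ : Fin m => V) K) : Prop :=
  ∀ i : Fin m, NondegenerateAt w i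

end Forms

section FormAlgebra

variable {K : Type u} [Field K] {g m : ℕ}

/-- The component `W_{λ_1 … λ_m} = w(e_{λ_1}, …, e_{λ_m})` in the canonical basis of `K^g`. -/
def component (w : MultilinearMap K (fun _ : Fin m => (Fin g → K)) K) (c : Fin m → Fin g) : K :=
  w fun i => Pi.single (c i) 1

/-- The word `(λ_1, …, λ_{m-N}, μ_1, …, μ_N)`. It is used for `N ≤ m` only. -/
def concat {N : ℕ} (l : Fin (m - N) → Fin g) (v : Fin N → Fin g) : Fin m → Fin g :=
  fun i => if h : i.val < m - N then l ⟨i.val, h⟩ else v ⟨i.val - (m - N), by omega⟩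

/-- The space of relations of `A(w,N)`, for `N ≤ m`: it is spanned by the tensors
`∑_μ W_{λ_1 … λ_{m-N} μ_1 … μ_N} x^{μ_1} ⊗ ⋯ ⊗ x^{μ_N}`. So `A(w,N)` is
`HomAlg (formRelations w N)`. -/
def formRelations (w : MultilinearMap K (fun _ : Fin m => (Fin g → K)) K) (N : ℕ) :
    Submodule K (Tensor K g N) :=
  Submodule.span K (Set.range fun (l : Fin (m - N) → Fin g) (v : Fin N → Fin g) =>
    component w (concat l v))

end FormAlgebra

end KoszulGorenstein

namespace KoszulGorenstein

universe u

/-! ### The degree filtration of `A(E,R)` and its components of degree 0 and 1. -/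

section Filtration

variable {K : Type u} [Field K] {g N : ℕ}

/-! Write `J_n` for `dualSpace R n` and `m = ν_N(D)`. The Koszul complex is a minimal free
resolution, since its differentials raise the degree in `A`. Hence global dimension `D` forces
`K_{D+1} = 0` (`koszul_eq_zero`). Every linear form on `J_m` is then a cocycle of degree `D`, and by
minimality it is a coboundary only if it vanishes. Since `H^D` is one-dimensional, so is `J_m`. Its
generator `W` gives the components of `w` (`exists_fundamental_tensor`).

The vanishing of `H^n` for `n < D` says that a linear form on `J_{ν_N(n)}` killing all contractions
of `W` is a coboundary, hence zero. So `J_{ν_N(n)}` is spanned by contractions of `W`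
(`mem_contractions`). For `n = 2` this is `R = R_w`. For `n = D - 1` it expresses slices of `W` at
the last letter through slices at the first one, which produces `Q`. The generators `x^l` act by
zero on `H^D`, so each `x^l` is reached by a coboundary. This excludes `d^{N-1}` with `N ≥ 3` as
last differential and makes the first-letter slices independent (`linearIndependent_slices`).

For uniqueness, twisted cyclicity moves the relations from the last `N` places to all others, so the
components of any preregular `w` with `R = R_w` lie in the line `J_m` (`component_mem_dualSpace`).
-/

theorem algHom_ext {B : Type*} [Semiring B] [Algebra K B] {R : Submodule K (Tensor K g N)}
    {f f' : HomAlg R →ₐ[K] B} (h : ∀ l, f (gen R l) = f' (gen R l)) : f = f' := by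
  refine RingQuot.ringQuot_ext' (S := K) (s := Rel R) f f' ?_
  refine FreeAlgebra.hom_ext ?_
  funext l
  exact h l

/-- The algebra homomorphism with given values on the generators. -/
noncomputable def liftGen {B : Type*} [Semiring B] [Algebra K B] (R : Submodule K (Tensor K g N))
    (b : Fin g → B) (h : ∀ t ∈ R, FreeAlgebra.lift K b (toFree N t) = 0) : HomAlg R →ₐ[K] B :=
  RingQuot.liftAlgHom K (s := Rel R) ⟨FreeAlgebra.lift K b, by
    rintro a b ⟨t, ht, rfl, rfl⟩
    rw [h t ht, map_zero]⟩

@[simp] theorem liftGen_gen {B : Type*} [Semiring B] [Algebra K B]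
    (R : Submodule K (Tensor K g N)) (b : Fin g → B)
    (h : ∀ t ∈ R, FreeAlgebra.lift K b (toFree N t) = 0) (l : Fin g) :
    liftGen R b h (gen R l) = b l := by
  unfold liftGen gen
  exact (RingQuot.liftAlgHom_mkAlgHom_apply ..).trans (FreeAlgebra.lift_ι_apply ..)

@[simp] theorem augmentation_gen (hN : N ≠ 0) (R : Submodule K (Tensor K g N)) (l : Fin g) :
    augmentation hN R (gen R l) = 0 := by
  unfold augmentation gen
  exact (RingQuot.liftAlgHom_mkAlgHom_apply ..).trans (FreeAlgebra.lift_ι_apply ..)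

theorem lift_toFree {B : Type*} [Semiring B] [Algebra K B] (b : Fin g → B) (n : ℕ)
    (t : Tensor K g n) :
    FreeAlgebra.lift K b (toFree n t) = ∑ c, t c • (List.ofFn fun i => b (c i)).prod := by
  simp [toFree, Fintype.linearCombination_apply, map_list_prod, List.map_ofFn,
    Function.comp_def]

theorem mk_toFree {R : Submodule K (Tensor K g N)} {t : Tensor K g N} (ht : t ∈ R) :
    ∑ c, t c • (List.ofFn fun i => gen R (c i)).prod = 0 := by
  have h : RingQuot.mkAlgHom K (Rel R) (toFree N t) = RingQuot.mkAlgHom K (Rel R) 0 :=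
    RingQuot.mkAlgHom_rel K ⟨t, ht, rfl, rfl⟩
  rw [map_zero (RingQuot.mkAlgHom K (Rel R))] at h
  refine Eq.trans ?_ h
  simp only [toFree, Fintype.linearCombination_apply, map_sum, map_smul, map_list_prod,
    List.map_ofFn, Function.comp_def]
  rfl

open Polynomial in
theorem prod_ofFn_mul_X {A : Type*} [Semiring A] (n : ℕ) (b : Fin n → A) :
    (List.ofFn fun i => C (b i) * (X : A[X])).prod = C (List.ofFn b).prod * X ^ n := by
  induction n with
  | zero => simp
  | succ n ih =>
    simp only [List.ofFn_succ, List.prod_cons, ih, C_mul]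
    rw [mul_assoc, ← mul_assoc X, X_mul_C, pow_succ', mul_assoc, mul_assoc]

open Polynomial in
/-- The grading of `A(E,R)`, as the homomorphism multiplying the part of degree `n` by `X^n`. -/
noncomputable def grading (R : Submodule K (Tensor K g N)) : HomAlg R →ₐ[K] (HomAlg R)[X] :=
  liftGen R (fun l => C (gen R l) * X) fun t ht => by
    have := congrArg (fun a => C a * (X : (HomAlg R)[X]) ^ N) (mk_toFree ht)
    simp only [map_sum, map_zero, zero_mul, Finset.sum_mul] at this
    rw [lift_toFree, ← this]
    refine Finset.sum_congr rfl fun c _ => ?_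
    rw [prod_ofFn_mul_X, ← smul_C, smul_mul_assoc]

open Polynomial in
-- Evaluation at `X = 1` is a left inverse.
theorem grading_injective (R : Submodule K (Tensor K g N)) :
    Function.Injective (grading R) := by
  let e : (HomAlg R)[X] →ₐ[K] HomAlg R :=
    { eval₂RingHom' (RingHom.id (HomAlg R)) 1 (fun a => Commute.one_right _) with
      commutes' := fun k => by
        change eval₂ (RingHom.id (HomAlg R)) 1 (algebraMap K (HomAlg R)[X] k) = _
        rw [Polynomial.algebraMap_apply, eval₂_C]; rfl }
  have h : e.comp (grading R) = AlgHom.id K _ := by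
    refine algHom_ext fun l => ?_
    change eval₂ (RingHom.id (HomAlg R)) 1 (grading R (gen R l)) = gen R l
    rw [grading, liftGen_gen, eval₂_mul_X, eval₂_C]
    simp
  intro a b hab
  have := congrArg e hab
  exact (DFunLike.congr_fun h a).symm.trans (this.trans (DFunLike.congr_fun h b))

open Polynomial in
/-- The elements of `A(E,R)` of order at least `n`. -/
def orderGE (R : Submodule K (Tensor K g N)) (n : ℕ) : Submodule K (HomAlg R) where
  carrier := {a | X ^ n ∣ grading R a}
  zero_mem' := by simp
  add_mem' := fun ha hb => by
    simp only [Set.mem_ofPred_eq, map_add] at *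
    exact dvd_add ha hb
  smul_mem' := fun k a ha => by
    simp only [Set.mem_ofPred_eq, map_smul, X_pow_dvd_iff, coeff_smul] at *
    intro d hd
    rw [ha d hd, smul_zero]

variable {R : Submodule K (Tensor K g N)}

open Polynomial in
theorem mem_orderGE {n : ℕ} {a : HomAlg R} : a ∈ orderGE R n ↔ X ^ n ∣ grading R a := Iff.rfl

theorem mem_orderGE_zero (a : HomAlg R) : a ∈ orderGE R 0 := by simp [mem_orderGE]

open Polynomial in
theorem mul_mem_orderGE {m n : ℕ} {a b : HomAlg R} (ha : a ∈ orderGE R m)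
    (hb : b ∈ orderGE R n) : a * b ∈ orderGE R (m + n) := by
  rw [mem_orderGE] at *
  obtain ⟨p, hp⟩ := ha
  obtain ⟨q, hq⟩ := hb
  refine ⟨p * q, ?_⟩
  rw [map_mul, hp, hq, pow_add, mul_assoc, mul_assoc, ← mul_assoc p, ← X_pow_mul, mul_assoc]

theorem orderGE_anti {m n : ℕ} (h : m ≤ n) {a : HomAlg R} (ha : a ∈ orderGE R n) :
    a ∈ orderGE R m :=
  (pow_dvd_pow _ h).trans ha

open Polynomial in
theorem gen_mem_orderGE (l : Fin g) : gen R l ∈ orderGE R 1 := by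
  rw [mem_orderGE, grading, liftGen_gen, pow_one, ← X_mul_C]
  exact dvd_mul_right _ _

open Polynomial in
-- The filtration is separated; this plays the role of the graded Nakayama lemma below.
theorem eq_zero_of_mem_orderGE {a : HomAlg R} (h : ∀ n, a ∈ orderGE R n) : a = 0 := by
  apply grading_injective R
  rw [map_zero]
  ext n
  exact X_pow_dvd_iff.1 (h (n + 1)) n n.lt_succ_self

open Polynomial in
theorem augmentation_eq_zero (hN : N ≠ 0) {a : HomAlg R} (ha : a ∈ orderGE R 1) :
    augmentation hN R a = 0 := by
  let e : (HomAlg R)[X] →ₐ[K] HomAlg R :=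
    { (constantCoeff : (HomAlg R)[X] →+* HomAlg R) with
      commutes' := fun k => by
        change constantCoeff (algebraMap K (HomAlg R)[X] k) = _
        rw [Polynomial.algebraMap_apply, constantCoeff_apply, coeff_C_zero] }
  have h : ((augmentation hN R).comp e).comp (grading R) = augmentation hN R := by
    refine algHom_ext fun l => ?_
    have : e (grading R (gen R l)) = 0 := by
      change constantCoeff (grading R (gen R l)) = 0
      rw [grading, liftGen_gen]
      simp
    simp [this]
  rw [← h]
  change augmentation hN R (coeff (grading R a) 0) = 0
  rw [X_pow_dvd_iff.1 ha 0 one_pos, map_zero]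

variable (R) in
open DualNumber in
/-- The homomorphism `A(E,R) → K[ε]` with `x^j ↦ ε` and `x^l ↦ 0` for `l ≠ j`. -/
noncomputable def toDual (hN : 2 ≤ N) (j : Fin g) :
    HomAlg R →ₐ[K] K[ε] :=
  liftGen R (fun l => Pi.single (M := fun _ => K[ε]) j ε l) fun t _ => by
    rw [lift_toFree]
    refine Finset.sum_eq_zero fun c _ => ?_
    obtain ⟨n, rfl⟩ := Nat.exists_eq_add_of_le' hN
    -- Since `N ≥ 2`, each monomial of a relation has two leading factors in `K ε`, and `ε² = 0`.
    have h (a b : Fin g) : Pi.single (M := fun _ => K[ε]) j ε a *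
        Pi.single (M := fun _ => K[ε]) j ε b = 0 := by
      by_cases ha : a = j <;> by_cases hb : b = j <;> simp [ha, hb]
    rw [List.ofFn_succ, List.ofFn_succ, List.prod_cons, List.prod_cons, ← mul_assoc, h, zero_mul,
      smul_zero]

open DualNumber in
theorem fst_toDual (hN : 2 ≤ N) (j : Fin g) (a : HomAlg R) :
    (toDual R hN j a).fst = augmentation (by omega) R a := by
  have : (TrivSqZeroExt.fstHom K K K).comp (toDual R hN j) = augmentation (by omega) R := by
    refine algHom_ext fun l => ?_
    by_cases hl : l = j <;> simp [toDual, Pi.single_apply, hl]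
  exact DFunLike.congr_fun this a

variable (R) in
/-- The coefficient of `x^j` in the component of degree `1`. -/
noncomputable def linCoeff (hN : 2 ≤ N) (j : Fin g)
    (a : HomAlg R) : K :=
  (toDual R hN j a).snd

theorem linCoeff_mul (hN : 2 ≤ N) (j : Fin g) (a b : HomAlg R) :
    linCoeff R hN j (a * b) = augmentation (by omega) R a * linCoeff R hN j b +
      linCoeff R hN j a * augmentation (by omega) R b := by
  simp [linCoeff, fst_toDual, mul_comm]

theorem linCoeff_gen (hN : 2 ≤ N) (j l : Fin g) :
    linCoeff R hN j (gen R l) = if l = j then 1 else 0 := by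
  by_cases hl : l = j <;> simp [linCoeff, toDual, Pi.single_apply, hl]

theorem linCoeff_sum (hN : 2 ≤ N) (j : Fin g) {ι : Type*} (s : Finset ι) (a : ι → HomAlg R) :
    linCoeff R hN j (∑ i ∈ s, a i) = ∑ i ∈ s, linCoeff R hN j (a i) := by
  classical
  induction s using Finset.induction_on with
  | empty => simp [linCoeff]
  | insert i s hi ih => rw [Finset.sum_insert hi, Finset.sum_insert hi, ← ih]; simp [linCoeff]

end Filtration

/-! ### Minimality of the Koszul complex, and its length. -/

section Complex

variable {K : Type u} [Field K] {g N : ℕ} {R : Submodule K (Tensor K g N)}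

theorem d_tmul (n : ℕ) (a : HomAlg R) (t : dualSpace R (n + 1)) :
    d R n (a ⊗ₜ t) = ∑ l, (a * gen R l) ⊗ₜ contract R n l t := by
  simp [d, LinearMap.sum_apply]

theorem apply_d {n : ℕ} (f : KN R n →ₗ[HomAlg R] HomAlg R) (a : HomAlg R)
    (t : dualSpace R (n + 1)) :
    f (d R n (a ⊗ₜ t)) = ∑ l, a * gen R l * f (1 ⊗ₜ contract R n l t) := by
  rw [d_tmul, map_sum]
  refine Finset.sum_congr rfl fun l _ => ?_
  rw [← smul_eq_mul (a * gen R l), ← map_smul, TensorProduct.smul_tmul', smul_eq_mul, mul_one]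

theorem apply_d_mem {n j : ℕ} {f : KN R n →ₗ[HomAlg R] HomAlg R}
    (hf : ∀ z, f z ∈ orderGE R j) (z : KN R (n + 1)) : f (d R n z) ∈ orderGE R (j + 1) := by
  induction z using TensorProduct.induction_on with
  | zero => rw [map_zero, map_zero]; exact zero_mem _
  | tmul a t =>
    rw [apply_d]
    refine Submodule.sum_mem _ fun l _ => ?_
    rw [mul_assoc]
    have := mul_mem_orderGE (mem_orderGE_zero a)
      (mul_mem_orderGE (gen_mem_orderGE l) (hf (1 ⊗ₜ contract R n l t)))
    rwa [zero_add, add_comm] at this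
  | add x y hx hy => rw [map_add, map_add]; exact add_mem hx hy

theorem apply_dPow_mem {n j : ℕ} {f : KN R n →ₗ[HomAlg R] HomAlg R}
    (hf : ∀ z, f z ∈ orderGE R j) (k : ℕ) (z : KN R (n + k)) :
    f (dPow R n k z) ∈ orderGE R (j + k) := by
  induction k with
  | zero => exact hf z
  | succ k ih => exact apply_d_mem (f := f ∘ₗ dPow R n k) ih z

theorem linCoeff_apply_d (hN : 2 ≤ N) {n : ℕ} (f : KN R n →ₗ[HomAlg R] HomAlg R) (j : Fin g)
    (a : HomAlg R) (t : dualSpace R (n + 1)) :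
    linCoeff R hN j (f (d R n (a ⊗ₜ t))) =
      augmentation (by omega) R a * augmentation (by omega) R (f (1 ⊗ₜ contract R n j t)) := by
  rw [apply_d, linCoeff_sum, Finset.sum_eq_single j]
  · simp [linCoeff_mul, linCoeff_gen]
  · intro l _ hl
    simp [linCoeff_mul, linCoeff_gen, hl]
  · simp

/-- The cochain `a ⊗ t ↦ φ(t) a`. -/
noncomputable def evalCochain {n : ℕ} (φ : dualSpace R n →ₗ[K] K) :
    KN R n →ₗ[HomAlg R] HomAlg R :=
  (TensorProduct.AlgebraTensorModule.rid K (HomAlg R) (HomAlg R)).toLinearMap ∘ₗ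
    TensorProduct.AlgebraTensorModule.map LinearMap.id φ

@[simp] theorem evalCochain_tmul {n : ℕ} (φ : dualSpace R n →ₗ[K] K) (a : HomAlg R)
    (t : dualSpace R n) : evalCochain φ (a ⊗ₜ t) = φ t • a := by
  simp [evalCochain]

theorem eq_zero_of_evalCochain {n : ℕ} {z : KN R n}
    (h : ∀ φ : dualSpace R n →ₗ[K] K, evalCochain φ z = 0) : z = 0 := by
  let b := Module.Basis.ofVectorSpace K (dualSpace R n)
  apply (Algebra.TensorProduct.basis (HomAlg R) b).repr.injective
  rw [map_zero]
  ext i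
  rw [Finsupp.zero_apply, ← h (b.coord i)]
  generalize z = y
  induction y using TensorProduct.induction_on with
  | zero => simp
  | tmul a t =>
    rw [Algebra.TensorProduct.basis_repr_tmul, evalCochain_tmul]
    simp [Algebra.smul_def, Algebra.commutes]
  | add x y hx hy => rw [map_add, map_add, Finsupp.add_apply, hx, hy]

/-- If the image of `d^k` is a direct summand, with projection `e`, then `f ∘ d^k = (f ∘ e) ∘ d^k`.
As `e` lands in the image of `d^k`, any bound on the order valid for all `f ∘ d^k` also holds for `f
∘ e`, and a further `d^k` improves it by `k`. The order is thus infinite. -/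
theorem dPow_eq_zero {n k : ℕ} (hk : 0 < k) (e : KN R n →ₗ[HomAlg R] KN R n)
    (he : ∀ z, e z ∈ LinearMap.range (dPow R n k))
    (he' : ∀ z, e (dPow R n k z) = dPow R n k z) : dPow R n k = 0 := by
  have key (j : ℕ) : ∀ (f : KN R n →ₗ[HomAlg R] HomAlg R) (z), f (dPow R n k z) ∈ orderGE R j := by
    induction j with
    | zero => exact fun _ _ => mem_orderGE_zero _
    | succ j ih =>
      intro f z
      rw [← he' z]
      refine orderGE_anti (by omega : j + 1 ≤ j + k) (apply_dPow_mem (f := f ∘ₗ e) (fun y => ?_) k z)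
      obtain ⟨x, hx⟩ := he y
      rw [LinearMap.comp_apply, ← hx]
      exact ih f x
  refine LinearMap.ext fun z => ?_
  exact eq_zero_of_evalCochain fun φ => eq_zero_of_mem_orderGE fun j => key j _ z

theorem step_pos (hN : 2 ≤ N) (n : ℕ) : 0 < step N n := by
  unfold step
  split <;> omega

open CategoryTheory in
-- Dimension shifting: the cokernel of `δ n` has projective dimension at most `D - n`, so that of `δ
-- D` is projective and the image of `δ D` splits off.
theorem exists_retraction_range {A : Type u} [Ring A] {D : ℕ} (hD : HasGlobalDimension A D)
    (C : ℕ → Type u) [∀ n, AddCommGroup (C n)] [∀ n, Module A (C n)]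
    [∀ n, Module.Projective A (C n)] (δ : ∀ n, C (n + 1) →ₗ[A] C n)
    (hδ : ∀ n, Function.Exact (δ (n + 1)) (δ n)) :
    ∃ e : C D →ₗ[A] C D, (∀ z, e z ∈ LinearMap.range (δ D)) ∧ ∀ z, e (δ D z) = δ D z := by
  have hM (M : ModuleCat.{u} A) : HasProjectiveDimensionLT M (D + 1) := by
    have : projectiveDimension M ≤ D := hD ▸ le_iSup (fun M : ModuleCat.{u} A => projectiveDimension M) M
    exact (projectiveDimension_le_iff M D).1 this
  have key (n : ℕ) : n ≤ D → ∃ (P : ModuleCat.{u} A) (π : C n →ₗ[A] P),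
      Function.Surjective π ∧ LinearMap.ker π = LinearMap.range (δ n) ∧
      HasProjectiveDimensionLT P (D - n + 1) := by
    induction n with
    | zero =>
      exact fun _ => ⟨ModuleCat.of A (C 0 ⧸ LinearMap.range (δ 0)), Submodule.mkQ _,
        Submodule.mkQ_surjective _, Submodule.ker_mkQ _, hM _⟩
    | succ n ih =>
      intro hn
      obtain ⟨P, π, hπ, hker, hP⟩ := ih (by omega)
      refine ⟨ModuleCat.of A (LinearMap.ker π), (δ n).codRestrict (LinearMap.ker π)
        (fun z => hker ▸ LinearMap.mem_range_self _ _), ?_, ?_, ?_⟩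
      · rintro ⟨y, hy⟩
        rw [hker] at hy
        obtain ⟨x, rfl⟩ := hy
        exact ⟨x, rfl⟩
      · rw [LinearMap.ker_codRestrict]
        exact (hδ n).linearMap_ker_eq
      · have hse := LinearMap.shortExact_shortComplexKer (R := A) (M := C n) (N := P) hπ
        have h2 : Projective (ModuleCat.of A (C n)) :=
          (IsProjective.iff_projective (C n)).1 inferInstance
        have : HasProjectiveDimensionLT (ModuleCat.of A (C n)) (D - (n + 1) + 1) :=
          hasProjectiveDimensionLT_of_ge _ 1 _ (by omega)
        refine hse.hasProjectiveDimensionLT_X₁ _ this ?_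
        rw [show D - (n + 1) + 1 + 1 = D - n + 1 by omega]
        exact hP
  obtain ⟨P, π, hπ, hker, hP⟩ := key D le_rfl
  rw [Nat.sub_self, zero_add] at hP
  have : Module.Projective A P :=
    (IsProjective.iff_projective P).2 (projective_iff_hasProjectiveDimensionLT_one.2 hP)
  obtain ⟨σ, hσ⟩ := Module.projective_lifting_property π LinearMap.id hπ
  refine ⟨LinearMap.id - σ ∘ₗ π, fun z => ?_, fun z => ?_⟩
  · rw [← hker, LinearMap.mem_ker]
    have := LinearMap.congr_fun hσ (π z)
    simp only [LinearMap.comp_apply, LinearMap.id_apply] at this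
    simp [this]
  · have : δ D z ∈ LinearMap.ker π := hker ▸ LinearMap.mem_range_self _ _
    simp [LinearMap.mem_ker.1 this]

theorem koszul_eq_zero (hN : 2 ≤ N) {D : ℕ} (hK : IsKoszul R)
    (hD : HasGlobalDimension (HomAlg R) D) : Subsingleton (Koszul R (D + 1)) := by
  obtain ⟨e, he, he'⟩ := exists_retraction_range hD (Koszul R) (koszulD R) hK
  -- Once this differential vanishes, exactness makes the next one surjective, and the same argument
  -- with `e = id` kills that one too.
  have h0 : koszulD R D = 0 := dPow_eq_zero (step_pos hN D) e he he'
  have hs (z : Koszul R (D + 1)) : z ∈ LinearMap.range (koszulD R (D + 1)) :=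
    (hK D z).1 (by rw [h0]; rfl)
  have h1 : koszulD R (D + 1) = 0 :=
    dPow_eq_zero (step_pos hN (D + 1)) LinearMap.id hs fun _ => rfl
  have hz (z : Koszul R (D + 1)) : z = 0 := by
    obtain ⟨y, rfl⟩ := hs z
    rw [h1]; rfl
  exact ⟨fun x y => (hz x).trans (hz y).symm⟩

end Complex

/-! ### The top cohomology and the generator of the last dual space. -/

section Gorenstein

variable {K : Type u} [Field K] {g N : ℕ} {R : Submodule K (Tensor K g N)}

theorem mem_coboundaries_succ {n : ℕ} {f : Cochain R (n + 1)} :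
    f ∈ coboundaries R (n + 1) ↔ ∃ h : Cochain R n, ∀ z, f z = h (koszulD R n z) := by
  constructor
  · rintro ⟨h, rfl⟩
    exact ⟨h, fun _ => rfl⟩
  · rintro ⟨h, hh⟩
    exact ⟨h, LinearMap.ext fun z => (hh z).symm⟩

theorem coboundary_apply_mem (hN : 2 ≤ N) {n : ℕ} {f : Cochain R n} (hf : f ∈ coboundaries R n)
    (z : Koszul R n) : f z ∈ orderGE R 1 := by
  cases n with
  | zero =>
    have : f = 0 := hf
    rw [this]
    exact zero_mem _
  | succ n =>
    obtain ⟨h, hh⟩ := mem_coboundaries_succ.1 hf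
    rw [hh]
    exact orderGE_anti (by have := step_pos hN n; omega : 1 ≤ 0 + step N n)
      (apply_dPow_mem (fun _ => mem_orderGE_zero _) _ z)

/-- Coboundaries take values of order at least 1, whereas `1 ⊗ t` is sent to the scalar `φ t`. -/
theorem eq_zero_of_evalCochain_mem (hN : 2 ≤ N) {n : ℕ} {φ : dualSpace R (nu N n) →ₗ[K] K}
    (hφ : evalCochain φ ∈ coboundaries R n) : φ = 0 := by
  ext1 t
  have := augmentation_eq_zero (by omega) (coboundary_apply_mem hN hφ (1 ⊗ₜ t))
  simpa using this

theorem mem_coboundaries_of_exact {n : ℕ} (h : cohomology R n = ⊥) {f : Cochain R n}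
    (hf : ∀ z, f (koszulD R n z) = 0) : f ∈ coboundaries R n := by
  have h1 : (coboundaries R n).mkQ f ∈ cohomology R n :=
    Submodule.mem_map_of_mem (LinearMap.ext hf : coD R n f = 0)
  rw [h, Submodule.mem_bot] at h1
  exact (Submodule.Quotient.mk_eq_zero _).1 h1

theorem evalCochain_sub_smul {n : ℕ} (ψ φ : dualSpace R n →ₗ[K] K) (k : K) (z : KN R n) :
    evalCochain (ψ - k • φ) z = evalCochain ψ z - evalCochain φ z * algebraMap K (HomAlg R) k := by
  induction z using TensorProduct.induction_on with
  | zero => simp only [map_zero, zero_mul, sub_zero]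
  | tmul a t =>
    rw [evalCochain_tmul, evalCochain_tmul, evalCochain_tmul, ← Algebra.commutes,
      ← Algebra.smul_def, LinearMap.sub_apply, LinearMap.smul_apply, smul_smul, sub_smul,
      smul_eq_mul]
  | add x y hx hy =>
    rw [map_add, map_add, map_add, hx, hy, add_mul]
    abel

theorem exists_fundamental_tensor (hN : 2 ≤ N) {D : ℕ} (hK : IsKoszul R)
    (hD : HasGlobalDimension (HomAlg R) D) (hG : IsGorenstein (by omega) R D) :
    ∃ (W : dualSpace R (nu N D)) (φ : dualSpace R (nu N D) →ₗ[K] K), φ W = 1 ∧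
      (∀ t, t = φ t • W) ∧
      ∀ l, MulOpposite.op (gen R l) • (evalCochain φ : Cochain R D) ∈ coboundaries R D := by
  have hsub := koszul_eq_zero hN hK hD
  obtain ⟨-, Φ, hΦ⟩ := hG
  -- Every cochain of degree `D` is a cocycle because `K_{D+1} = 0`.
  have hmem (f : Cochain R D) : (coboundaries R D).mkQ f ∈ cohomology R D := by
    refine Submodule.mem_map_of_mem ?_
    refine LinearMap.ext fun z => ?_
    rw [Subsingleton.elim z 0, map_zero, map_zero]
  let cls (f : Cochain R D) : cohomology R D := ⟨_, hmem f⟩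
  have hcls (f : Cochain R D) : Φ (cls f) = 0 ↔ f ∈ coboundaries R D := by
    rw [map_eq_zero_iff Φ Φ.injective]
    refine Subtype.ext_iff.trans ?_
    exact Submodule.Quotient.mk_eq_zero _
  have hop (a : HomAlg R) (f : Cochain R D) :
      Φ (cls (MulOpposite.op a • f)) = Φ (cls f) * augmentation (by omega) R a :=
    hΦ (cls f) a
  have hsubcls (f f' : Cochain R D) : Φ (cls (f - f')) = Φ (cls f) - Φ (cls f') := by
    rw [← map_sub]; rfl
  obtain ⟨c, hc⟩ : ∃ c : cohomology R D, Φ c ≠ 0 := ⟨Φ.symm 1, by simp⟩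
  obtain ⟨f, hf⟩ := Submodule.mkQ_surjective _ c.1
  obtain ⟨z, hz⟩ : ∃ z, f z ≠ 0 := by
    by_contra! h
    have : f = 0 := LinearMap.ext h
    apply hc
    have h0 : c = 0 := Subtype.ext (by rw [← hf, this]; exact map_zero _)
    rw [h0, map_zero]
  obtain ⟨W, hW⟩ : ∃ W : dualSpace R (nu N D), W ≠ 0 := by
    by_contra! h
    apply hz
    have : z = 0 := eq_zero_of_evalCochain fun φ => by
      have : (evalCochain φ : Cochain R D) = 0 := by
        ext t
        rw [h t]
        simp
      rw [this]
      rfl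
    rw [this, map_zero]
  obtain ⟨φ, hφ⟩ := Module.Projective.exists_dual_eq_one K hW
  have hne : Φ (cls (evalCochain φ)) ≠ 0 := fun h => by
    have := eq_zero_of_evalCochain_mem hN ((hcls _).1 h)
    simp [this] at hφ
  refine ⟨W, φ, hφ, fun t => ?_, fun l => ?_⟩
  · rw [← sub_eq_zero]
    by_contra h
    obtain ⟨ψ, hψ⟩ := Module.Projective.exists_dual_eq_one K h
    -- This scalar makes the class of `ψ - k • φ` vanish, so `ψ = k • φ`. But `φ` kills `t - φ t •
    -- W`, on which `ψ` is 1.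
    set k := Φ (cls (evalCochain ψ)) / Φ (cls (evalCochain φ)) with hk
    have h1 : (evalCochain (ψ - k • φ) : Cochain R D) =
        evalCochain ψ - MulOpposite.op (algebraMap K (HomAlg R) k) • evalCochain φ := by
      refine LinearMap.ext fun z => ?_
      exact evalCochain_sub_smul ψ φ k z
    have h2 : (evalCochain (ψ - k • φ) : Cochain R D) ∈ coboundaries R D := by
      rw [← hcls, h1, hsubcls, hop, AlgHom.commutes, Algebra.algebraMap_self, RingHom.id_apply, hk]
      field_simp
      simp
    have h3 := eq_zero_of_evalCochain_mem hN h2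
    rw [sub_eq_zero] at h3
    rw [h3] at hψ
    simp [hφ] at hψ
  · rw [← hcls, hop, augmentation_gen, mul_zero]

end Gorenstein

/-! ### Contractions of the generator span the dual spaces. -/

section Contractions

variable {K : Type u} [Field K] {g N : ℕ} {R : Submodule K (Tensor K g N)}

/-- The span of the contractions of `W` over its first `m - n` letters. -/
def contractions {m : ℕ} (W : Tensor K g m) (n : ℕ) : Submodule K (Tensor K g n) :=
  Submodule.span K (Set.range fun (l : Fin (m - n) → Fin g) (v : Fin n → Fin g) => W (concat l v))

theorem slice_mem_contractions {m n : ℕ} (hn : n + 1 ≤ m) {W : Tensor K g m}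
    {t : Tensor K g (n + 1)} (ht : t ∈ contractions W (n + 1)) (x : Fin g) :
    (fun c => t (Fin.cons x c)) ∈ contractions W n := by
  induction ht using Submodule.span_induction with
  | mem t ht =>
    obtain ⟨l, rfl⟩ := ht
    refine Submodule.subset_span
      ⟨fun i => if h : i.val < m - (n + 1) then l ⟨i.val, h⟩ else x, ?_⟩
    funext c
    refine congrArg W (funext fun i => ?_)
    simp only [concat]
    by_cases h1 : i.val < m - (n + 1)
    · rw [dif_pos h1, dif_pos (by omega), dif_pos h1]
    · rw [dif_neg h1]
      by_cases h2 : i.val < m - n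
      · rw [dif_pos h2, dif_neg h1]
        have : (⟨i.val - (m - (n + 1)), by omega⟩ : Fin (n + 1)) = 0 :=
          Fin.ext (by simp only [Fin.val_zero]; omega)
        rw [this, Fin.cons_zero]
      · rw [dif_neg h2]
        have : (⟨i.val - (m - (n + 1)), by omega⟩ : Fin (n + 1)) =
            Fin.succ ⟨i.val - (m - n), by omega⟩ :=
          Fin.ext (by simp only [Fin.val_succ]; omega)
        rw [this, Fin.cons_succ]
  | zero => exact zero_mem _
  | add s t _ _ hs ht => exact add_mem hs ht
  | smul k t _ ht => exact Submodule.smul_mem _ k ht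

theorem apply_dPow_eq_zero {m n : ℕ} {W : Tensor K g m} {f : KN R n →ₗ[HomAlg R] HomAlg R}
    (hf : ∀ t : dualSpace R n, t.1 ∈ contractions W n → f (1 ⊗ₜ t) = 0) (k : ℕ)
    (hk : n + k ≤ m) (t : dualSpace R (n + k)) (ht : t.1 ∈ contractions W (n + k)) :
    f (dPow R n k (1 ⊗ₜ t)) = 0 := by
  induction k with
  | zero => exact hf t ht
  | succ k ih =>
    change (f ∘ₗ dPow R n k) (d R (n + k) (1 ⊗ₜ t)) = 0
    rw [apply_d]
    refine Finset.sum_eq_zero fun l _ => ?_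
    rw [LinearMap.comp_apply, ih (by omega) _ (slice_mem_contractions hk ht l), mul_zero]

theorem self_mem_contractions {m : ℕ} (W : Tensor K g m) : W ∈ contractions W m := by
  refine Submodule.subset_span ⟨fun i => absurd i.isLt (by omega), ?_⟩
  funext c
  refine congrArg W (funext fun i => ?_)
  rw [concat, dif_neg (by omega)]
  congr 1
  exact Fin.ext (by simp)

theorem nu_mono : Monotone (nu N) := monotone_nat_of_le_succ fun _ => Nat.le_add_right _ _

/-- Descending induction on `n`. A linear form `ψ` on `J_{ν_N(n)}` that kills the contractions of
`W` is a cocycle, because `J_{ν_N(n+1)}` already consists of contractions and slicing keeps them so.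
By exactness it is a coboundary, hence zero. -/
theorem mem_contractions (hN : 2 ≤ N) {D : ℕ} (hG : ∀ n < D, cohomology R n = ⊥)
    {W : dualSpace R (nu N D)} {φ : dualSpace R (nu N D) →ₗ[K] K} (hW : ∀ t, t = φ t • W)
    {n : ℕ} (hn : n ≤ D) : ∀ t : dualSpace R (nu N n), t.1 ∈ contractions W.1 (nu N n) := by
  induction hn using Nat.decreasingInduction with
  | self =>
    intro t
    rw [hW t]
    exact Submodule.smul_mem _ _ (self_mem_contractions W.1)
  | of_succ n hn ih =>
    intro t
    by_contra ht
    let p := (contractions W.1 (nu N n)).comap (dualSpace R (nu N n)).subtype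
    obtain ⟨ψ, hψ, hp⟩ := Submodule.exists_le_ker_of_notMem (p := p) (v := t) ht
    refine hψ ?_
    have : ψ = 0 := by
      refine eq_zero_of_evalCochain_mem hN (n := n) (mem_coboundaries_of_exact (hG n hn) fun z => ?_)
      induction z using TensorProduct.induction_on with
      | zero => rw [map_zero, map_zero]
      | tmul a t =>
        rw [← mul_one a, ← smul_eq_mul, ← TensorProduct.smul_tmul', map_smul, map_smul]
        refine smul_eq_zero_of_right a (apply_dPow_eq_zero (W := W.1) (fun s hs => ?_) _
          (nu_mono (show n + 1 ≤ D from hn)) t (ih t))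
        have : ψ s = 0 := hp hs
        rw [evalCochain_tmul, this, zero_smul]
      | add x y hx hy => rw [map_add, map_add, hx, hy, add_zero]
    rw [this, LinearMap.zero_apply]

/-- Rests on `J_N = R`. The variable `a` stands for `nu N 2`, which equals `N` only propositionally.
-/
theorem eq_contractions [NeZero g] {m a : ℕ} (hm : N ≤ m) (ha : a = N) {W : Tensor K g m}
    (hW : W ∈ dualSpace R m) (h : ∀ t : dualSpace R a, t.1 ∈ contractions W a) :
    R = contractions W N := by
  subst ha
  refine le_antisymm (fun t ht => h ⟨t, fun r hr c => ?_⟩) (Submodule.span_le.2 ?_)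
  · obtain rfl : r = 0 := by omega
    convert ht using 2 with v
    refine congrArg t (funext fun i => ?_)
    simp [overwrite]
  · rintro _ ⟨l, rfl⟩
    refine (congrArg (· ∈ R) (funext fun v => ?_)).mpr
      (hW (m - a) (by omega) (concat l fun _ => 0))
    refine congrArg W (funext fun i => ?_)
    simp only [concat, overwrite]
    by_cases hi : i.val < m - a
    · rw [dif_pos hi, dif_neg (by omega), dif_pos hi]
    · rw [dif_neg hi, dif_pos (by omega)]

/-- With `W_j` the slice of `W` at first letter `j`, `f (d (1 ⊗ W)) = ∑ x^j f (1 ⊗ W_j)`. Comparing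
linear parts with `x^l`, the form `t ↦ ε (f (1 ⊗ t))` is 1 on `W_l` and 0 on the other slices: the
slices have a dual family. -/
theorem linearIndependent_slices (hN : 2 ≤ N) {a : ℕ} (W : dualSpace R (a + 1))
    (h : ∀ l, ∃ f : KN R a →ₗ[HomAlg R] HomAlg R, f (d R a (1 ⊗ₜ W)) = gen R l) :
    LinearIndependent K fun (l : Fin g) (c : Fin a → Fin g) => W.1 (Fin.cons l c) := by
  rw [Fintype.linearIndependent_iff]
  intro X hX l
  obtain ⟨f, hf⟩ := h l
  have hX' : ∑ j, X j • contract R a j W = 0 := by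
    apply Subtype.ext
    rw [AddSubmonoidClass.coe_finsetSum]
    exact hX
  have hj (j : Fin g) :
      augmentation (by omega) R (f (1 ⊗ₜ contract R a j W)) = if l = j then 1 else 0 := by
    rw [← linCoeff_gen hN (R := R), ← hf, linCoeff_apply_d, map_one, one_mul]
  have hsum : ∑ j, X j • (1 : HomAlg R) ⊗ₜ[K] contract R a j W = 0 := by
    simp_rw [← TensorProduct.tmul_smul, ← TensorProduct.tmul_sum, hX', TensorProduct.tmul_zero]
  have h0 : ∑ j, X j * augmentation (by omega) R (f (1 ⊗ₜ contract R a j W)) = 0 := by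
    have := congrArg (fun z => augmentation (by omega) R (f z)) hsum
    simpa only [map_sum, LinearMap.map_smul_of_tower, map_smul, map_zero, smul_eq_mul] using this
  simpa [hj] using h0

/-- The linear part of `f ∘ d^k` is the augmentation of values of `f ∘ d^{k-1}`, which have order at
least `k - 1 ≥ 1`. -/
theorem linCoeff_apply_dPow_eq_zero (hN : 2 ≤ N) {n k : ℕ} (hk : 2 ≤ k)
    (f : KN R n →ₗ[HomAlg R] HomAlg R) (j : Fin g) (t : dualSpace R (n + k)) :
    linCoeff R hN j (f (dPow R n k (1 ⊗ₜ t))) = 0 := by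
  obtain ⟨k, rfl⟩ := Nat.exists_eq_add_of_le' hk
  change linCoeff R hN j ((f ∘ₗ dPow R n (k + 1)) (d R (n + (k + 1)) (1 ⊗ₜ t))) = 0
  rw [linCoeff_apply_d, map_one, one_mul]
  refine augmentation_eq_zero (by omega) ?_
  exact orderGE_anti (by omega : 1 ≤ 0 + (k + 1)) (apply_dPow_mem (fun _ => mem_orderGE_zero _) _ _)

theorem snoc_overwrite {n : ℕ} (l : Fin g) (r : ℕ) (hr : r + N ≤ n) (c : Fin n → Fin g)
    (v : Fin N → Fin g) :
    (Fin.snoc (overwrite r c v) l : Fin (n + 1) → Fin g) = overwrite r (Fin.snoc c l) v := by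
  funext i
  refine Fin.lastCases ?_ (fun j => ?_) i
  · rw [Fin.snoc_last, overwrite, dif_neg (by simp only [Fin.val_last]; omega), Fin.snoc_last]
  · simp only [overwrite, Fin.snoc_castSucc, Fin.val_castSucc]

theorem snoc_mem_dualSpace {n : ℕ} {t : Tensor K g (n + 1)} (ht : t ∈ dualSpace R (n + 1))
    (l : Fin g) : (fun c => t (Fin.snoc c l)) ∈ dualSpace R n := fun r hr c => by
  simp only [snoc_overwrite l r hr]
  exact ht r (by omega) (Fin.snoc c l)

theorem contractions_succ_le {a : ℕ} (W : Tensor K g (a + 1)) :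
    contractions W a ≤ Submodule.span K (Set.range fun l c => W (Fin.cons l c)) := by
  refine Submodule.span_mono ?_
  rintro _ ⟨l, rfl⟩
  refine ⟨l ⟨0, by omega⟩, funext fun c => congrArg W (funext fun i => ?_)⟩
  refine Fin.cases ?_ (fun j => ?_) i
  · rw [Fin.cons_zero, concat, dif_pos (by simp)]
    rfl
  · rw [Fin.cons_succ, concat, dif_neg (by simp only [Fin.val_succ]; omega)]
    congr 1
    exact Fin.ext (by simp)

end Contractions

/-! ### Preregular forms and their components. -/

section MultilinearForms

variable {K : Type u} [Field K] {g m : ℕ}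

/-- The multilinear form with given components. -/
noncomputable def ofComponents (W : Tensor K g m) :
    MultilinearMap K (fun _ : Fin m => (Fin g → K)) K :=
  ∑ c, W c • (MultilinearMap.mkPiAlgebra K (Fin m) K).compLinearMap fun i => LinearMap.proj (c i)

@[simp] theorem component_ofComponents (W : Tensor K g m) : component (ofComponents W) = W := by
  funext c
  rw [component, ofComponents, _root_.sum_apply, Finset.sum_eq_single c]
  · simp
  · intro b _ hb
    obtain ⟨i, hi⟩ := Function.ne_iff.1 hb
    have : ∏ j, (Pi.single (c j) 1 : Fin g → K) (b j) = 0 :=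
      Finset.prod_eq_zero (Finset.mem_univ i) (by simp [hi])
    simp [this]
  · simp

theorem ext_component {w w' : MultilinearMap K (fun _ : Fin m => (Fin g → K)) K}
    (h : component w = component w') : w = w' := by
  refine Module.Basis.ext_multilinear (fun _ => Pi.basisFun K (Fin g)) fun c => ?_
  simpa [component] using congrFun h c

theorem map_update_eq_sum (w : MultilinearMap K (fun _ : Fin m => (Fin g → K)) K)
    (Y : Fin m → Fin g → K) (i : Fin m) (X : Fin g → K) :
    w (Function.update Y i X) = ∑ l, X l * w (Function.update Y i (Pi.single l 1)) := by
  have h := LinearMap.pi_apply_eq_sum_univ (w.toLinearMap Y i) X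
  simp only [MultilinearMap.toLinearMap_apply, smul_eq_mul] at h
  rw [h]
  refine Finset.sum_congr rfl fun l _ => ?_
  congr 3
  funext j
  simp [Pi.single_apply, eq_comm]

/-- The family `(Q X_m, X_1, …, X_{m-1})`, for any map `Q`. -/
def rotate {V : Type*} (Q : V → V) (X : Fin m → V) : Fin m → V :=
  fun i => if i.val = 0 then Q (X ⟨m - 1, by have := i.isLt; omega⟩)
    else X ⟨i.val - 1, by have := i.isLt; omega⟩

/-- Rotation carries the argument at site `j` unchanged to site `j + 1`, so degeneracy descends from
each site to the preceding one, finally to the first. -/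
theorem apply_update_eq_zero_of_succ {V : Type*} [AddCommGroup V] [Module K V] {Q : V → V}
    {w : MultilinearMap K (fun _ : Fin m => V) K} (hw : ∀ X : Fin m → V, w X = w (rotate Q X))
    {X : V} {i j : Fin m} (hij : i.val = j.val + 1)
    (h : ∀ Y : Fin m → V, w (Function.update Y i X) = 0) (Y : Fin m → V) :
    w (Function.update Y j X) = 0 := by
  have hi : rotate Q (Function.update Y j X) i = X := by
    have hj : (⟨i.val - 1, by omega⟩ : Fin m) = j := Fin.ext (by simp only; omega)
    rw [rotate, if_neg (by omega), hj, Function.update_self]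
  rw [hw, ← Function.update_eq_self i (rotate Q _), hi, h]

theorem nondegenerateAt_of_rotate {V : Type*} [AddCommGroup V] [Module K V] {Q : V → V}
    {w : MultilinearMap K (fun _ : Fin m => V) K}
    (hw : ∀ X : Fin m → V, w X = w (rotate Q X))
    (h0 : ∀ i : Fin m, i.val = 0 → NondegenerateAt w i)
    (i : Fin m) : NondegenerateAt w i := by
  obtain ⟨n, hn⟩ := i
  induction n with
  | zero => exact h0 _ rfl
  | succ n ih =>
    exact fun X hX => ih (by omega) X (apply_update_eq_zero_of_succ hw (by rfl) hX)

theorem IsPreregular.isOneSiteNondegenerate {V : Type*} [AddCommGroup V] [Module K V]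
    {w : MultilinearMap K (fun _ : Fin m => V) K} (h : IsPreregular w) :
    IsOneSiteNondegenerate w := by
  obtain ⟨h0, Q, hQ⟩ := h
  exact nondegenerateAt_of_rotate (Q := Q) hQ h0

theorem cons_single (l : Fin g) (c : Fin m → Fin g) :
    (Fin.cons (Pi.single l 1) fun i => Pi.single (c i) 1 : Fin (m + 1) → Fin g → K) =
      fun i => Pi.single (Fin.cons (α := fun _ => Fin g) l c i) 1 := by
  funext i
  refine Fin.cases ?_ (fun j => ?_) i
  · rw [Fin.cons_zero, Fin.cons_zero]
  · rw [Fin.cons_succ, Fin.cons_succ]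

theorem rotate_eq_cons {V : Type*} (Q : V → V) (X : Fin (m + 1) → V) :
    rotate Q X = Fin.cons (Q (X (Fin.last m))) fun i => X i.castSucc := by
  funext i
  refine Fin.cases ?_ (fun j => ?_) i
  · rw [Fin.cons_zero]
    rfl
  · rw [Fin.cons_succ]
    rfl

theorem rotate_of_component {w : MultilinearMap K (fun _ : Fin (m + 1) => (Fin g → K)) K}
    {Q : (Fin g → K) →ₗ[K] (Fin g → K)}
    (h : ∀ l (c : Fin m → Fin g), component w (Fin.snoc c l) =
      ∑ k, Q (Pi.single l 1) k * component w (Fin.cons k c)) (X : Fin (m + 1) → Fin g → K) :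
    w X = w (rotate Q X) := by
  rw [rotate_eq_cons]
  let w' : MultilinearMap K (fun _ : Fin (m + 1) => (Fin g → K)) K :=
    (w.compLinearMap fun i => Fin.cons (α := fun _ => (Fin g → K) →ₗ[K] (Fin g → K)) Q
      (fun _ => LinearMap.id) i).domDomCongr (finRotate (m + 1)).symm
  have hw' (X : Fin (m + 1) → Fin g → K) :
      w' X = w (Fin.cons (Q (X (Fin.last m))) fun i => X i.castSucc) := by
    simp only [w', MultilinearMap.domDomCongr_apply, MultilinearMap.compLinearMap_apply]
    refine congrArg w (funext fun i => ?_)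
    refine Fin.cases ?_ (fun j => ?_) i
    · have : (finRotate (m + 1)).symm 0 = Fin.last m :=
        (Equiv.symm_apply_eq _).2 finRotate_last.symm
      rw [Fin.cons_zero, Fin.cons_zero, this]
    · have : (finRotate (m + 1)).symm j.succ = j.castSucc :=
        (Equiv.symm_apply_eq _).2 (finRotate_of_lt j.isLt).symm
      rw [Fin.cons_succ, Fin.cons_succ, this, LinearMap.id_apply]
  rw [← hw']
  refine DFunLike.congr_fun (ext_component ?_) X
  funext c
  rw [← Fin.snoc_init_self c, h, component, hw']
  have := map_update_eq_sum w
    (Fin.cons 0 fun i => Pi.single (Fin.init c i) 1) 0 (Q (Pi.single (c (Fin.last m)) 1))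
  simp only [Fin.update_cons_zero] at this
  simp only [Fin.snoc_last, Fin.snoc_castSucc]
  rw [this]
  simp only [cons_single]
  rfl

theorem isPreregular_ofComponents {W : Tensor K g (m + 1)}
    (hW : LinearIndependent K fun (l : Fin g) (c : Fin m → Fin g) => W (Fin.cons l c))
    (h : ∀ l, (fun c => W (Fin.snoc c l)) ∈
      Submodule.span K (Set.range fun (l : Fin g) (c : Fin m → Fin g) => W (Fin.cons l c))) :
    IsPreregular (ofComponents W) := by
  have h0 (i : Fin (m + 1)) (hi : i.val = 0) : NondegenerateAt (ofComponents W) i := by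
    obtain rfl : i = 0 := Fin.ext hi
    intro X hX
    refine funext fun l => Fintype.linearIndependent_iff.1 hW X (funext fun c => ?_) l
    have := hX (Fin.cons 0 fun i => Pi.single (c i) 1)
    rw [map_update_eq_sum] at this
    simp only [Fin.update_cons_zero, cons_single] at this
    rw [Finset.sum_apply, ← component_ofComponents W]
    simpa [component] using this
  simp only [Submodule.mem_span_range_iff_exists_fun] at h
  -- The coefficients of the last-letter slices in the first-letter slices are the columns of `Q`.
  choose q hq using h
  let Q : (Fin g → K) →ₗ[K] (Fin g → K) := Matrix.mulVecLin (Matrix.of fun k l => q l k)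
  have hQ := rotate_of_component (w := ofComponents W) (Q := Q) fun l c => by
    rw [component_ofComponents, ← congrFun (hq l) c]
    simp [Q, Finset.sum_apply]
  -- A vector killed by `Q` is, after one rotation, in the radical of the last site, which is
  -- trivial. This needs cyclicity for a `Q` not yet known to be invertible.
  have hinj : Function.Injective Q := by
    rw [← LinearMap.ker_eq_bot, LinearMap.ker_eq_bot']
    intro X hX
    refine nondegenerateAt_of_rotate (Q := Q) hQ h0 (Fin.last m) X fun Y => ?_
    rw [hQ]
    refine MultilinearMap.map_coord_zero _ 0 ?_
    exact (congrArg Q (Function.update_self (Fin.last m) X Y)).trans hX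
  exact ⟨h0, LinearEquiv.ofInjectiveEndo Q hinj, hQ⟩

/-- The family `Y` with the vectors at the places `r, …, r+N-1` replaced by basis vectors. -/
def placeBasis {N : ℕ} (r : ℕ) (Y : Fin m → Fin g → K) (v : Fin N → Fin g) : Fin m → Fin g → K :=
  fun i => if h : r ≤ i.val ∧ i.val < r + N then Pi.single (v ⟨i.val - r, by omega⟩) 1 else Y i

/-- By multilinearity, the outer arguments may be arbitrary vectors; `k` bounds the number of
leading places still to be expanded in the basis. -/
theorem placeBasis_mem_formRelations_last [NeZero g] {N : ℕ} (hN : N ≤ m)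
    (w : MultilinearMap K (fun _ : Fin m => (Fin g → K)) K) (k : ℕ) :
    ∀ Y : Fin m → Fin g → K, (∀ i : Fin m, k ≤ i.val → i.val < m - N →
      ∃ j, Y i = Pi.single j 1) →
      (fun v => w (placeBasis (m - N) Y v)) ∈ formRelations w N := by
  induction k with
  | zero =>
    intro Y hY
    have hY' (i : Fin (m - N)) : ∃ j, Y ⟨i.val, by omega⟩ = Pi.single j 1 :=
      hY ⟨i.val, by omega⟩ (Nat.zero_le _) i.isLt
    choose l hl using hY'
    refine Submodule.subset_span ⟨l, funext fun v => congrArg w (funext fun i => ?_)⟩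
    simp only [concat, placeBasis]
    by_cases hi : i.val < m - N
    · rw [dif_pos hi, dif_neg (by omega), ← hl ⟨i.val, hi⟩]
    · rw [dif_neg hi, dif_pos (by omega)]
  | succ k ih =>
    intro Y hY
    by_cases hk : k < m - N
    · let k' : Fin m := ⟨k, by omega⟩
      have hp (X : Fin g → K) (v : Fin N → Fin g) :
          placeBasis (m - N) (Function.update Y k' X) v =
            Function.update (placeBasis (m - N) Y v) k' X := by
        funext i
        by_cases hi : i = k'
        · subst hi
          rw [Function.update_self, placeBasis, dif_neg (by simp only [k']; omega),
            Function.update_self]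
        · rw [Function.update_of_ne hi, placeBasis, placeBasis, Function.update_of_ne hi]
      have h : (fun v : Fin N → Fin g => w (placeBasis (m - N) Y v)) = ∑ l, Y k' l • fun v =>
          w (placeBasis (m - N) (Function.update Y k' (Pi.single l 1)) v) := by
        funext v
        rw [Finset.sum_apply]
        conv_lhs => rw [← Function.update_eq_self k' Y, hp, map_update_eq_sum]
        simp [hp]
      rw [h]
      refine Submodule.sum_mem _ fun l _ => Submodule.smul_mem _ _ (ih _ fun i hi hi' => ?_)
      by_cases hik : i = k'
      · exact ⟨l, by rw [hik, Function.update_self]⟩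
      · rw [Function.update_of_ne hik]
        exact hY i (Nat.lt_of_le_of_ne hi fun h => hik (Fin.ext h.symm)) hi'
    · exact ih Y fun i hi hi' => absurd hi' (by omega)

/-- One rotation moves the block of `N` free places from `r` to `r + 1` and applies `Q` only to an
outer argument, so everything reduces to the last block `r = m - N`. -/
theorem placeBasis_mem_formRelations [NeZero g] {N : ℕ} (hN : N ≤ m)
    {w : MultilinearMap K (fun _ : Fin m => (Fin g → K)) K} {Q : (Fin g → K) ≃ₗ[K] (Fin g → K)}
    (hQ : IsTwistedCyclic w Q) {r : ℕ} (hr : r ≤ m - N) :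
    ∀ Y : Fin m → Fin g → K, (fun v => w (placeBasis r Y v)) ∈ formRelations w N := by
  induction hr using Nat.decreasingInduction with
  | self =>
    exact fun Y => placeBasis_mem_formRelations_last hN w m Y fun i _ => absurd i.isLt (by omega)
  | of_succ r hr ih =>
    intro Y
    have h (v : Fin N → Fin g) :
        twistedRotate Q (placeBasis r Y v) = placeBasis (r + 1) (twistedRotate Q Y) v := by
      funext i
      simp only [twistedRotate, placeBasis]
      by_cases hi : i.val = 0
      · rw [if_pos hi, if_pos hi, dif_neg (by omega), dif_neg (by omega)]
      · rw [if_neg hi, if_neg hi]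
        by_cases hi' : r ≤ i.val - 1 ∧ i.val - 1 < r + N
        · rw [dif_pos hi', dif_pos (by omega)]
          congr 3
          omega
        · rw [dif_neg hi', dif_neg (by omega)]
    simp only [hQ (placeBasis r Y _), h]
    exact ih _

theorem component_mem_dualSpace [NeZero g] {N : ℕ} (hN : N ≤ m)
    {w : MultilinearMap K (fun _ : Fin m => (Fin g → K)) K} (hw : IsPreregular w) :
    component w ∈ dualSpace (formRelations w N) m := fun r hr c => by
  obtain ⟨-, Q, hQ⟩ := hw
  refine (congrArg (· ∈ formRelations w N) (funext fun v => congrArg w (funext fun i => ?_))).mpr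
    (placeBasis_mem_formRelations hN hQ (r := r) (by omega) fun i => Pi.single (c i) 1)
  simp only [overwrite, placeBasis]
  split <;> rfl

theorem IsPreregular.component_ne_zero [NeZero g] (hm : m ≠ 0)
    {w : MultilinearMap K (fun _ : Fin m => (Fin g → K)) K} (hw : IsPreregular w) :
    component w ≠ 0 := fun h => by
  have h0 : w = 0 := ext_component h
  have := hw.1 ⟨0, by omega⟩ rfl (Pi.single 0 1) fun Y => by rw [h0]; rfl
  simpa using congrFun this 0

end MultilinearForms

/-! ### Assembly of the main theorem. -/

section MainTheorem

variable {K : Type u} [Field K] {g N : ℕ} {R : Submodule K (Tensor K g N)}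

theorem exists_apply_koszulD_eq_gen {D : ℕ} {W : dualSpace R (nu N (D + 1))}
    {φ : dualSpace R (nu N (D + 1)) →ₗ[K] K} (hφ : φ W = 1) {l : Fin g}
    (h : MulOpposite.op (gen R l) • (evalCochain φ : Cochain R (D + 1)) ∈
      coboundaries R (D + 1)) :
    ∃ f : Cochain R D, f (koszulD R D (1 ⊗ₜ W)) = gen R l := by
  obtain ⟨f, hf⟩ := mem_coboundaries_succ.1 h
  refine ⟨f, ?_⟩
  rw [← hf, LinearMap.smul_apply, evalCochain_tmul, hφ, one_smul, op_smul_eq_mul,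
    one_mul]

theorem gen_ne_zero (hN : 2 ≤ N) (l : Fin g) : gen R l ≠ 0 := fun h => by
  have := linCoeff_gen hN (R := R) l l
  simp [h, linCoeff] at this

/-- The length `k` is a variable because the type of `W` involves `step N D`. If `a` were 0, the `g
≥ 2` independent slices would lie in a line. -/
theorem ne_zero_and_isPreregular (hN : 2 ≤ N) {a k : ℕ} (hk : k = 1) (hg : 2 ≤ g)
    (W : dualSpace R (a + k))
    (h : ∀ l, ∃ f : KN R a →ₗ[HomAlg R] HomAlg R, f (dPow R a k (1 ⊗ₜ W)) = gen R l)
    (hW : ∀ t : dualSpace R a, t.1 ∈ contractions W.1 a) :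
    a ≠ 0 ∧ IsPreregular (ofComponents W.1) := by
  subst hk
  have hli := linearIndependent_slices hN W h
  refine ⟨?_, isPreregular_ofComponents hli fun l => contractions_succ_le W.1 <|
    hW ⟨_, snoc_mem_dualSpace W.2 l⟩⟩
  rintro rfl
  have := hli.fintype_card_le_finrank
  simp only [Fintype.card_fin, Module.finrank_fintype_fun_eq_card, Fintype.card_pi,
    Finset.univ_eq_empty, Finset.prod_empty] at this
  omega

end MainTheorem

end KoszulGorenstein

open KoszulGorenstein in
theorem theorem11 {K : Type*} [Field K] (s N D : ℕ) (hs : 1 ≤ s) (hN : 2 ≤ N)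
    (R : Submodule K (Tensor K (s + 1) N))
    (hKoszul : IsKoszul R)
    (hD : HasGlobalDimension (HomAlg R) D)
    (hGor : IsGorenstein (by omega) R D) :
    ∃ m : ℕ, N ≤ m ∧
      (3 ≤ N → ∃ p : ℕ, 1 ≤ p ∧ m = N * p + 1 ∧ D = 2 * p + 1) ∧
      (N = 2 → m = D) ∧
      (∃ w : MultilinearMap K (fun _ : Fin m => (Fin (s + 1) → K)) K,
        IsPreregular w ∧ IsOneSiteNondegenerate w ∧ R = formRelations w N) ∧
      ∀ w w' : MultilinearMap K (fun _ : Fin m => (Fin (s + 1) → K)) K,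
        IsPreregular w → R = formRelations w N →
        IsPreregular w' → R = formRelations w' N →
        ∃ c : K, c ≠ 0 ∧ w' = c • w := by
  obtain ⟨W, φ, hφ, hW, hgen⟩ := exists_fundamental_tensor hN hKoszul hD hGor
  have hcon (n : ℕ) (hn : n ≤ D) := mem_contractions hN hGor.1 hW hn
  obtain _ | D := D
  -- For global dimension 0 there are no nonzero coboundaries, so `x^0` would vanish in `A`.
  · have h0 : MulOpposite.op (gen R 0) • (evalCochain φ : Cochain R 0) = 0 := hgen 0
    have h1 := LinearMap.congr_fun h0 (1 ⊗ₜ W)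
    rw [LinearMap.smul_apply, evalCochain_tmul, hφ, one_smul, op_smul_eq_mul,
      one_mul] at h1
    exact absurd h1 (gen_ne_zero hN 0)
  -- From here on the global dimension is `D + 1`.
  have hgen' (l : Fin (s + 1)) := exists_apply_koszulD_eq_gen hφ (hgen l)
  have hstep : step N D = 1 := by
    by_contra hne
    obtain ⟨f, hf⟩ := hgen' 0
    have h1 := linCoeff_gen hN (R := R) 0 0
    rw [← hf, if_pos rfl] at h1
    have h2 := linCoeff_apply_dPow_eq_zero hN (k := step N D)
      (by have := step_pos hN D; omega) f 0 W
    exact zero_ne_one (h2.symm.trans h1)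
  obtain ⟨hnu, hpre⟩ := ne_zero_and_isPreregular hN hstep (by omega) W hgen' (hcon D (by omega))
  have hD0 : D ≠ 0 := by
    rintro rfl
    exact hnu rfl
  have hnu2 : nu N 2 = N := by simpa using nu_even (N := N) (by omega) 1
  have hNm : N ≤ nu N (D + 1) := by
    conv_lhs => rw [← hnu2]
    exact nu_mono (by omega)
  refine ⟨nu N (D + 1), hNm, fun h3 => ?_, ?_, ⟨ofComponents W.1, hpre,
    hpre.isOneSiteNondegenerate, ?_⟩, fun w w' hw hR hw' hR' => ?_⟩
  · have hev : Even D := by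
      by_contra h
      rw [step, if_neg h] at hstep
      omega
    obtain ⟨p, rfl⟩ := hev.two_dvd
    exact ⟨p, by omega, nu_odd (by omega) p, rfl⟩
  · rintro rfl
    obtain ⟨p, hp | hp⟩ := (D + 1).even_or_odd'
    · rw [hp, nu_even (by omega)]
    · rw [hp, nu_odd (by omega)]
  · refine (eq_contractions hNm hnu2 W.2 (hcon 2 (by omega))).trans ?_
    rw [formRelations, component_ofComponents, contractions]
  · have hmem : component w ∈ dualSpace R (nu N (D + 1)) := by
      conv => rw [hR]
      exact component_mem_dualSpace hNm hw
    have hmem' : component w' ∈ dualSpace R (nu N (D + 1)) := by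
      conv => rw [hR']
      exact component_mem_dualSpace hNm hw'
    -- Both component tensors lie on the line spanned by `W`.
    obtain ⟨a, h1⟩ : ∃ a : K, component w = a • W.1 :=
      ⟨_, congrArg Subtype.val (hW ⟨_, hmem⟩)⟩
    obtain ⟨b, h2⟩ : ∃ b : K, component w' = b • W.1 :=
      ⟨_, congrArg Subtype.val (hW ⟨_, hmem'⟩)⟩
    have ha : a ≠ 0 := fun h => hw.component_ne_zero (by omega) (by rw [h1, h, zero_smul])
    have hb : b ≠ 0 := fun h =>
      hw'.component_ne_zero (by omega) (by rw [h2, h, zero_smul])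
    refine ⟨b / a, div_ne_zero hb ha, ext_component ?_⟩
    change component w' = (b / a) • component w
    rw [h1, h2, smul_smul, div_mul_cancel₀ _ ha]
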